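/- **Types and functionals.** The types of finite rank are generated from the type $0$ by $(\sigma_1,\dots,\sigma_n\to 0)$, $n\ge 1$, also written in curried form $\sigma_1\to(\sigma_2,\dots,\sigma_n\to 0)$. The rank is $\mathbf r(0)=0$, $\mathbf r(\sigma_1,\dots,\sigma_n\to0)=\max_i(\mathbf r(\sigma_i)+1)$, and $\mathbf{Ty}(k)$ is the set of types of rank $\le k$. Put $\mathbb N_\bot=\mathbb N\cup\{\bot\}$, $\mathbf F(0)=\mathbb N$, $\mathbf P(0)=\mathbb N_\bot$; for $\sigma=(\sigma_1,\dots,\sigma_n\to0)$ let $\mathbf F(\sigma)$ be the set of all maps $\mathbf F(\sigma_1)\times\cdots\times\mathbf F(\sigma_n)\to\mathbb N$ and $\mathbf P(\sigma)\supseteq\mathbf F(\sigma)$ the set of all maps $\mathbf F(\sigma_1)\times\cdots\times\mathbf F(\sigma_n)\to\mathbb N_\bot$, ordered by extension. **Terms.** The typed terms are: $\hat 0$ of type $0$; $\mathsf{suc}$ and $\mathsf{pred}$ of type $0\to0$; $\mathsf{case}\,t_1t_2t_3$ of type $0$ for terms $t_1,t_2,t_3$ of type $0$ (so $\mathsf{case}$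 occurs only together with its three arguments); variables $x_i^\sigma$ $(i\in\mathbb N)$ of type $\sigma$ and a secondary constant $\hat\phi$ of type $\sigma$ for each $\phi\in\mathbf P(\sigma)$, where $\sigma\in\mathbf{Ty}(3)$; applications $(ts)$ of type $\tau$ for $t$ of type $\sigma\to\tau$ and $s$ of type $\sigma$; abstractions $(\lambda x_i^\sigma t)$ of type $\sigma\to\tau$ for $t$ of type $\tau$, if $\mathbf r(\sigma\to\tau)\le3$; and $(\mu x_i^\sigma t)$ of type $\sigma$ for $t$ of type $\sigma$, if $\mathbf r(\sigma)\le3$. A term is closed if it has no free variables. **Interpretation.** Under an assignment of elements of $\mathbf P(\sigma)$ to the variables of type $\sigma$, each term $t$ of type $\tau$ has an interpretation $[[t]]\in\mathbf P(\tau)$. Here $\hat0$, $\mathsf{suc}$, $\mathsf{pred}$ are $0$, successor and predecessor (with $\mathsf{pred}(0)=0$); $[[\hat\phi]]=\phi$; a variable is interpreted by its assigned value; $[[\mathsf{case}\,t_1t_2t_3]]$ is $[[t_2]]$ if $[[t_1]]=0$, is $[[t_3]]$ if $[[t_1]]\in\mathbb N$ is positive, and is $\bot$ if $[[t_1]]=\bot$;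 $[[ts]]=[[t]]([[s]])$ if $[[s]]$ is total, and $[[ts]]$ is everywhere undefined otherwise; $[[\lambda x\,t]]$ sends a total $\phi$ to the interpretation of $t$ with $x$ assigned $\phi$; and $[[\mu x\,t]]$ is the least fixed point of the monotone map sending $\psi$ to the interpretation of $t$ with $x$ assigned $\psi$. For closed $t$ this does not depend on the assignment. **Computation trees.** For a closed term $t$ of type $0$, the computation tree $T[t]$ is a set of finite sequences of terms. It contains the empty sequence and the one-term sequence $t$, and it contains $t$ followed by any sequence of one of its immediate subtrees. The immediate subtrees, and the value of $T[t]$ (the values being assigned inductively, bottom-up), are as follows. - $t=\hat0$: there is no subtree and the value is $0$. More generally, $t=\hat k$ for a secondary constant with $k\in\mathbb N$ has no subtree and has value $k$, and $t=\hat\bot$ has no subtree and no value. - $t=\mathsf{suc}\,t_1$ or $t=\mathsf{pred}\,t_1$: the subtree is $T[t_1]$. If it has value $a$, then $T[t]$ has value $a+1$, respectively $\mathsf{pred}(a)$. - $t=\mathsf{case}\,t_1t_2t_3$: $T[t_1]$ is a subtree. If $T[t_1]$ has a value $a$, then $T[t_2]$ (if $a=0$) or $T[t_3]$ (if $a>0$)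 is also a subtree, and its value, if any, is the value of $T[t]$. - $t=\hat\Phi\,t_2\cdots t_n$ with $n\ge2$ and $\hat\Phi$ a secondary constant, where $t_2$ has type $(\delta_1,\dots,\delta_m\to0)$: the trees $T[t_2\hat\phi_1\cdots\hat\phi_m]$ for all $(\phi_1,\dots,\phi_m)\in\mathbf F(\delta_1)\times\cdots\times\mathbf F(\delta_m)$ are subtrees. If all of them have values, these define a total functional $\Psi_2$; with $\xi=\Phi(\Psi_2)$, the tree $T[\hat\xi\,t_3\cdots t_n]$ is then also a subtree, and its value, if any, is the value of $T[t]$. (For $t_2$ of type $0$ we have $m=0$.) - $t=(\lambda x\,t_1)t_2\cdots t_n$ with $n\ge2$: as in the previous item with $t_2$, but with $T[t_1[x/t_2]\,t_3\cdots t_n]$ in place of $T[\hat\xi\,t_3\cdots t_n]$. - $t=(\mu x\,t_1)t_2\cdots t_n$ with $n\ge1$: the subtree is $T[t_1[x/(\mu x\,t_1)]\,t_2\cdots t_n]$, and its value, if any, is the value of $T[t]$. A tree is well-founded if it has no infinite branch. **Theorem.** Let $t$ be a closed term of type $0$ and let $n\in\mathbb N$. The following are equivalent: 1. the interpretation of $t$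 satisfies $[[t]]=n$; 2. the tree $T[t]$ is well-founded and has value $n$. -/

import Mathlib

namespace PartialLambda

/-! ### Types, total functionals and partial functionals -/

/-- The types of finite rank: `0` and, in curried form, `(σ₁, …, σₙ → 0) = σ₁ → (… → (σₙ → 0))`. -/
inductive Ty : Type
  | zero : Ty
  | arrow (σ τ : Ty) : Ty
  deriving DecidableEq

/-- `r(0) = 0` and `r(σ₁, …, σₙ → 0) = max (r(σᵢ) + 1)`. -/
def Ty.rank : Ty → ℕ
  | .zero => 0
  | .arrow σ τ => max (σ.rank + 1) τ.rank

theorem Ty.rank_dom {σ τ : Ty} (h : (Ty.arrow σ τ).rank ≤ 3) : σ.rank ≤ 3 := by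
  simp only [Ty.rank] at h
  omega

theorem Ty.rank_cod {σ τ : Ty} (h : (Ty.arrow σ τ).rank ≤ 3) : τ.rank ≤ 3 := by
  simp only [Ty.rank] at h
  omega

/-- `F σ`: the total functionals of type `σ`, all of whose arguments are total. -/
def F : Ty → Type
  | .zero => ℕ
  | .arrow σ τ => F σ → F τ

/-- `P σ`: the partial functionals of type `σ`; the arguments are total, the values lie in
`Part ℕ = ℕ ∪ {⊥}`. -/
def P : Ty → Type
  | .zero => Part ℕ
  | .arrow σ τ => F σ → P τ

/-- The inclusion of `F σ` in `P σ`. -/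
def F.toP : {σ : Ty} → F σ → P σ
  | .zero, k => Part.some k
  | .arrow _ _, f => fun ξ => (f ξ).toP

/-- The product `F δ₁ × ⋯ × F δₘ` of the argument types of `σ = (δ₁, …, δₘ → 0)`. -/
def Inputs : Ty → Type
  | .zero => Unit
  | .arrow σ τ => F σ × Inputs τ

/-- The value `f(ξ₁, …, ξₘ)` of a total functional. -/
def F.eval : {σ : Ty} → F σ → Inputs σ → ℕ
  | .zero, k, _ => k
  | .arrow _ _, f, ξs => (f ξs.1).eval ξs.2

/-- The extension order on `P σ`: pointwise, with the flat order on `ℕ ∪ {⊥}`. -/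
instance P.instPartialOrder : (σ : Ty) → PartialOrder (P σ)
  | .zero => inferInstanceAs (PartialOrder (Part ℕ))
  | .arrow σ τ =>
    letI := P.instPartialOrder τ
    inferInstanceAs (PartialOrder (F σ → P τ))

/-- The everywhere undefined functional. -/
def P.undef : (σ : Ty) → P σ
  | .zero => (Part.none : Part ℕ)
  | .arrow _ τ => fun _ => P.undef τ

/-- Application of partial functionals, everywhere undefined unless the argument is total. -/
noncomputable def P.app {σ τ : Ty} (u : P (.arrow σ τ)) (v : P σ) : P τ :=
  open Classical in
  if h : ∃ ξ : F σ, ξ.toP = v then u h.choose else P.undef τ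

/-- `case (z, x, y)` is `x` if `z = 0` and `y` if `z > 0`; it is undefined if `z` is undefined, but
only the selected one of `x` and `y` needs to be defined. -/
def P.case (z x y : Part ℕ) : Part ℕ :=
  z.bind fun k => if k = 0 then x else y

/-- The least fixed point of `f`; for monotone `f` it exists, see `P.isLeast_lfp`. -/
noncomputable def P.lfp {σ : Ty} (f : P σ → P σ) : P σ :=
  open Classical in
  if h : ∃ ψ : P σ, IsLeast {ψ | f ψ = ψ} ψ then h.choose else P.undef σ

/-! ### Terms -/

/-- The typed terms of the language. `var i` at type `σ` is the variable `x_i^σ`, and `const φ` is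
the secondary constant for the partial functional `φ`. Since `case` inspects only one of its last
two arguments, it is a term former: it occurs together with its three arguments. -/
inductive Term : Ty → Type
  | zero : Term .zero
  | suc : Term (.arrow .zero .zero)
  | pred : Term (.arrow .zero .zero)
  | case (t₁ t₂ t₃ : Term .zero) : Term .zero
  | var {σ : Ty} (h : σ.rank ≤ 3) (i : ℕ) : Term σ
  | const {σ : Ty} (h : σ.rank ≤ 3) (φ : P σ) : Term σ
  | app {σ τ : Ty} (t : Term (.arrow σ τ)) (s : Term σ) : Term τ
  | lam {σ τ : Ty} (h : (Ty.arrow σ τ).rank ≤ 3) (i : ℕ) (t : Term τ) : Term (.arrow σ τ)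
  | mu {σ : Ty} (h : σ.rank ≤ 3) (i : ℕ) (t : Term σ) : Term σ

theorem Term.rank_le {σ : Ty} (t : Term σ) : σ.rank ≤ 3 := by
  induction t with
  | zero => simp [Ty.rank]
  | suc => simp [Ty.rank]
  | pred => simp [Ty.rank]
  | case => simp [Ty.rank]
  | var h => exact h
  | const h => exact h
  | app _ _ ih _ => exact Ty.rank_cod ih
  | lam h => exact h
  | mu h => exact h

/-- `t.FreeIn σ i`: the variable `x_i^σ` occurs free in `t`. -/
def Term.FreeIn (σ : Ty) (i : ℕ) : {τ : Ty} → Term τ → Prop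
  | _, .zero => False
  | _, .suc => False
  | _, .pred => False
  | _, .case t₁ t₂ t₃ => t₁.FreeIn σ i ∨ t₂.FreeIn σ i ∨ t₃.FreeIn σ i
  | _, .var (σ := σ') _ j => σ' = σ ∧ j = i
  | _, .const _ _ => False
  | _, .app t s => t.FreeIn σ i ∨ s.FreeIn σ i
  | _, .lam (σ := σ') _ j t => ¬ (σ' = σ ∧ j = i) ∧ t.FreeIn σ i
  | _, .mu (σ := σ') _ j t => ¬ (σ' = σ ∧ j = i) ∧ t.FreeIn σ i

/-- A closed term has no free variables. -/
def Term.Closed {τ : Ty} (t : Term τ) : Prop :=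
  ∀ (σ : Ty) (i : ℕ), ¬ t.FreeIn σ i

/-- `t.subst i s = t[x_i^σ / s]`: all free occurrences of `x_i^σ` in `t` are replaced by `s`. It is
only used with closed `s`, so no variable is captured. -/
def Term.subst : {τ : Ty} → Term τ → {σ : Ty} → ℕ → Term σ → Term τ
  | _, .zero, _, _, _ => .zero
  | _, .suc, _, _, _ => .suc
  | _, .pred, _, _, _ => .pred
  | _, .case t₁ t₂ t₃, _, i, s => .case (t₁.subst i s) (t₂.subst i s) (t₃.subst i s)
  | _, .var (σ := σ') h j, σ, i, s => if e : σ = σ' ∧ j = i then e.1 ▸ s else .var h j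
  | _, .const h φ, _, _, _ => .const h φ
  | _, .app t u, _, i, s => .app (t.subst i s) (u.subst i s)
  | _, .lam (σ := σ') h j t, σ, i, s => .lam h j (if σ = σ' ∧ j = i then t else t.subst i s)
  | _, .mu (σ := σ') h j t, σ, i, s => .mu h j (if σ = σ' ∧ j = i then t else t.subst i s)

/-! ### Denotational semantics -/

/-- An assignment of partial functionals to all variables. -/
def Env : Type := (σ : Ty) → ℕ → P σ

/-- The assignment that agrees with `ρ` except that `x_i^σ` is sent to `φ`. -/
def Env.update (ρ : Env) {σ : Ty} (i : ℕ) (φ : P σ) : Env := fun τ j =>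
  if e : σ = τ ∧ j = i then e.1 ▸ φ else ρ τ j

/-- The interpretation `[[t]]` of a term under an assignment. -/
noncomputable def Term.interp : {σ : Ty} → Term σ → Env → P σ
  | _, .zero, _ => (Part.some 0 : Part ℕ)
  | _, .suc, _ => fun k : ℕ => (Part.some (k + 1) : Part ℕ)
  | _, .pred, _ => fun k : ℕ => (Part.some (k - 1) : Part ℕ)
  | _, .case t₁ t₂ t₃, ρ => P.case (t₁.interp ρ) (t₂.interp ρ) (t₃.interp ρ)
  | σ, .var _ i, ρ => ρ σ i
  | _, .const _ φ, _ => φ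
  | _, .app t s, ρ => P.app (t.interp ρ) (s.interp ρ)
  | _, .lam _ i t, ρ => fun ξ => t.interp (ρ.update i ξ.toP)
  | _, .mu _ i t, ρ => P.lfp fun ψ => t.interp (ρ.update i ψ)

/-! ### Computation trees -/

/-- Lists `t₂, …, tₙ` of arguments that turn a term of type `σ` into one of type `0`. -/
inductive Args : Ty → Type
  | nil : Args .zero
  | cons {σ τ : Ty} (t : Term σ) (ts : Args τ) : Args (.arrow σ τ)

/-- The iterated application `t₁ t₂ ⋯ tₙ` of type `0`. -/
def Term.apps : {σ : Ty} → Term σ → Args σ → Term .zero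
  | _, t, .nil => t
  | _, t, .cons s ts => (Term.app t s).apps ts

/-- The term `t ξ₁ ⋯ ξₘ` of type `0`, for total `ξ₁, …, ξₘ` (as secondary constants). -/
def Term.applyTotal : {σ : Ty} → Term σ → Inputs σ → Term .zero
  | .zero, t, _ => t
  | .arrow _ _, t, ξs =>
    (Term.app t (.const (Ty.rank_dom t.rank_le) ξs.1.toP)).applyTotal ξs.2

/-- `TreeValue t n`: the computation tree of the closed term `t` of type `0` has the value `n`.
Values are assigned bottom-up. -/
inductive TreeValue : Term .zero → ℕ → Prop
  | zero : TreeValue .zero 0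
  | suc {t₁ : Term .zero} {a : ℕ} : TreeValue t₁ a → TreeValue (.app .suc t₁) (a + 1)
  | pred {t₁ : Term .zero} {a : ℕ} : TreeValue t₁ a → TreeValue (.app .pred t₁) (a - 1)
  | case_zero {t₁ t₂ t₃ : Term .zero} {n : ℕ} :
      TreeValue t₁ 0 → TreeValue t₂ n → TreeValue (.case t₁ t₂ t₃) n
  | case_succ {t₁ t₂ t₃ : Term .zero} {a n : ℕ} :
      TreeValue t₁ (a + 1) → TreeValue t₃ n → TreeValue (.case t₁ t₂ t₃) n
  /- A secondary constant of type `0` without arguments: its value is itself, if defined. -/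
  | const_zero (h : Ty.zero.rank ≤ 3) (k : ℕ) :
      TreeValue (.const h (Part.some k : Part ℕ)) k
  | const {σ τ : Ty} (h : (Ty.arrow σ τ).rank ≤ 3) (Φ : P (.arrow σ τ)) {t₂ : Term σ}
      {ts : Args τ} (Ψ : F σ) {n : ℕ} :
      (∀ ξs : Inputs σ, TreeValue (t₂.applyTotal ξs) (Ψ.eval ξs)) →
      TreeValue ((Term.const (Ty.rank_cod h) (Φ Ψ)).apps ts) n →
      TreeValue ((Term.const h Φ).apps (.cons t₂ ts)) n
  | lam {σ τ : Ty} (h : (Ty.arrow σ τ).rank ≤ 3) (i : ℕ) {t₁ : Term τ} {t₂ : Term σ}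
      {ts : Args τ} (Ψ : F σ) {n : ℕ} :
      (∀ ξs : Inputs σ, TreeValue (t₂.applyTotal ξs) (Ψ.eval ξs)) →
      TreeValue ((t₁.subst i t₂).apps ts) n →
      TreeValue ((Term.lam h i t₁).apps (.cons t₂ ts)) n
  | mu {σ : Ty} (h : σ.rank ≤ 3) (i : ℕ) {t₁ : Term σ} {ts : Args σ} {n : ℕ} :
      TreeValue ((t₁.subst i (.mu h i t₁)).apps ts) n →
      TreeValue ((Term.mu h i t₁).apps ts) n

/-- `Child t s`: the tree of `s` is one of the immediate subtrees of the tree of `t`. -/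
inductive Child : Term .zero → Term .zero → Prop
  | suc {t₁ : Term .zero} : Child (.app .suc t₁) t₁
  | pred {t₁ : Term .zero} : Child (.app .pred t₁) t₁
  | case_test {t₁ t₂ t₃ : Term .zero} : Child (.case t₁ t₂ t₃) t₁
  | case_zero {t₁ t₂ t₃ : Term .zero} : TreeValue t₁ 0 → Child (.case t₁ t₂ t₃) t₂
  | case_succ {t₁ t₂ t₃ : Term .zero} {a : ℕ} :
      TreeValue t₁ (a + 1) → Child (.case t₁ t₂ t₃) t₃
  | const_arg {σ τ : Ty} (h : (Ty.arrow σ τ).rank ≤ 3) (Φ : P (.arrow σ τ)) {t₂ : Term σ}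
      {ts : Args τ} (ξs : Inputs σ) :
      Child ((Term.const h Φ).apps (.cons t₂ ts)) (t₂.applyTotal ξs)
  | const_val {σ τ : Ty} (h : (Ty.arrow σ τ).rank ≤ 3) (Φ : P (.arrow σ τ)) {t₂ : Term σ}
      {ts : Args τ} (Ψ : F σ) :
      (∀ ξs : Inputs σ, TreeValue (t₂.applyTotal ξs) (Ψ.eval ξs)) →
      Child ((Term.const h Φ).apps (.cons t₂ ts))
        ((Term.const (Ty.rank_cod h) (Φ Ψ)).apps ts)
  | lam_arg {σ τ : Ty} (h : (Ty.arrow σ τ).rank ≤ 3) (i : ℕ) {t₁ : Term τ} {t₂ : Term σ}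
      {ts : Args τ} (ξs : Inputs σ) :
      Child ((Term.lam h i t₁).apps (.cons t₂ ts)) (t₂.applyTotal ξs)
  | lam_body {σ τ : Ty} (h : (Ty.arrow σ τ).rank ≤ 3) (i : ℕ) {t₁ : Term τ} {t₂ : Term σ}
      {ts : Args τ} (Ψ : F σ) :
      (∀ ξs : Inputs σ, TreeValue (t₂.applyTotal ξs) (Ψ.eval ξs)) →
      Child ((Term.lam h i t₁).apps (.cons t₂ ts)) ((t₁.subst i t₂).apps ts)
  | mu {σ : Ty} (h : σ.rank ≤ 3) (i : ℕ) {t₁ : Term σ} {ts : Args σ} :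
      Child ((Term.mu h i t₁).apps ts) ((t₁.subst i (.mu h i t₁)).apps ts)

/-- `InTree t l`: the finite sequence `l` of terms belongs to the computation tree of `t`. -/
inductive InTree : Term .zero → List (Term .zero) → Prop
  | root (t : Term .zero) : InTree t []
  | single (t : Term .zero) : InTree t [t]
  | step {t s : Term .zero} {l : List (Term .zero)} : Child t s → InTree s l → InTree t (t :: l)

/-- The computation tree `T[t]`, a set of finite sequences of terms. -/
def tree (t : Term .zero) : Set (List (Term .zero)) := {l | InTree t l}

/-- A tree of finite sequences is well-founded if it has no infinite branch. -/
def WellFoundedTree {α : Type} (T : Set (List α)) : Prop :=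
  ¬ ∃ f : ℕ → α, ∀ k : ℕ, (List.range k).map f ∈ T

/-! ### The least fixed points used in the interpretation exist -/

theorem P.undef_le : {σ : Ty} → (φ : P σ) → P.undef σ ≤ φ
  | .zero, φ => (bot_le : (⊥ : Part ℕ) ≤ φ)
  | .arrow _ _, φ => fun ξ => P.undef_le (φ ξ)

theorem F.eq_of_toP_le : {σ : Ty} → {ξ : F σ} → {φ : P σ} → ξ.toP ≤ φ → φ = ξ.toP
  | .zero, k, _, h => (Part.eq_some_iff.2 (h k (Part.mem_some _)) : _ = Part.some k)
  | .arrow _ _, _, _, h => funext fun a => F.eq_of_toP_le (h a)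

theorem F.toP_injective : {σ : Ty} → Function.Injective (F.toP (σ := σ))
  | .zero => fun _ _ h => Part.some_injective h
  | .arrow _ _ => fun _ _ h => funext fun a => F.toP_injective (congrFun h a)

theorem P.app_toP {σ τ : Ty} (u : P (.arrow σ τ)) (ξ : F σ) : P.app u ξ.toP = u ξ := by
  have h : ∃ ξ' : F σ, ξ'.toP = ξ.toP := ⟨ξ, rfl⟩
  rw [P.app, dif_pos h, F.toP_injective h.choose_spec]

theorem P.app_mono {σ τ : Ty} {u u' : P (.arrow σ τ)} {v v' : P σ} (hu : u ≤ u') (hv : v ≤ v') :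
    P.app u v ≤ P.app u' v' := by
  by_cases h : ∃ ξ : F σ, ξ.toP = v
  · obtain ⟨ξ, rfl⟩ := h
    rw [F.eq_of_toP_le hv, P.app_toP, P.app_toP]
    exact hu ξ
  · rw [P.app, dif_neg h]
    exact P.undef_le _

theorem P.case_mono {z z' x x' y y' : Part ℕ} (hz : z ≤ z') (hx : x ≤ x') (hy : y ≤ y') :
    P.case z x y ≤ P.case z' x' y' := by
  intro n hn
  obtain ⟨k, hk, hn⟩ := Part.mem_bind_iff.1 hn
  refine Part.mem_bind_iff.2 ⟨k, hz k hk, ?_⟩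
  split_ifs at hn ⊢
  · exact hx n hn
  · exact hy n hn

theorem P.exists_isLUB_of_isChain : (σ : Ty) → (c : Set (P σ)) → IsChain (· ≤ ·) c →
    ∃ b, IsLUB c b
  | .zero, c, hc => by
    by_cases h : ∃ x : Part ℕ, x ∈ c ∧ ∃ n, n ∈ x
    · obtain ⟨x, hx, n, hn⟩ := h
      refine ⟨x, fun y hy => ?_, fun y hy => hy hx⟩
      rcases hc.total hx hy with h | h
      · have hyn : (y : Part ℕ) = Part.some n := Part.eq_some_iff.2 (h n hn)
        have hxn : x = Part.some n := Part.eq_some_iff.2 hn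
        exact le_of_eq (hyn.trans hxn.symm)
      · exact h
    · refine ⟨P.undef _, fun y hy n hn => (h ⟨y, hy, n, hn⟩).elim, fun y _ => P.undef_le y⟩
  | .arrow σ τ, c, hc => by
    have key : ∀ ξ : F σ, ∃ b : P τ, IsLUB ((fun φ : P (.arrow σ τ) => φ ξ) '' c) b := fun ξ =>
      P.exists_isLUB_of_isChain τ _ <| by
        rintro _ ⟨φ, hφ, rfl⟩ _ ⟨ψ, hψ, rfl⟩ _
        exact (hc.total hφ hψ).imp (fun h => h ξ) (fun h => h ξ)
    choose b hb using key
    exact ⟨b, fun φ hφ ξ => (hb ξ).1 ⟨φ, hφ, rfl⟩, fun φ hφ ξ => (hb ξ).2 <| by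
      rintro _ ⟨ψ, hψ, rfl⟩
      exact hφ hψ ξ⟩

theorem P.exists_isLeast_fixedPoint {σ : Ty} {f : P σ → P σ} (hf : Monotone f) :
    ∃ ψ : P σ, IsLeast {ψ | f ψ = ψ} ψ := by
  obtain ⟨m, hm⟩ := zorn_le₀ {x : P σ | x ≤ f x ∧ ∀ y, f y = y → x ≤ y} <| by
    intro c hcs hc
    obtain ⟨b, hb⟩ := P.exists_isLUB_of_isChain σ c hc
    exact ⟨b, ⟨hb.2 fun x hx => (hcs hx).1.trans (hf (hb.1 hx)),
      fun y hy => hb.2 fun x hx => (hcs hx).2 y hy⟩, fun x hx => hb.1 hx⟩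
  have hfm : f m ≤ m :=
    hm.2 ⟨hf hm.1.1, fun y hy => (hf (hm.1.2 y hy)).trans (le_of_eq hy)⟩ hm.1.1
  exact ⟨m, le_antisymm hfm hm.1.1, fun y hy => hm.1.2 y hy⟩

theorem P.isLeast_lfp {σ : Ty} {f : P σ → P σ} (hf : Monotone f) :
    IsLeast {ψ | f ψ = ψ} (P.lfp f) := by
  have h := P.exists_isLeast_fixedPoint hf
  rw [P.lfp, dif_pos h]
  exact h.choose_spec

theorem P.lfp_mono {σ : Ty} {f g : P σ → P σ} (hf : Monotone f) (hg : Monotone g)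
    (h : ∀ ψ, f ψ ≤ g ψ) : P.lfp f ≤ P.lfp g := by
  obtain ⟨m, hm⟩ := zorn_le₀ {x : P σ | x ≤ f x ∧ x ≤ P.lfp f ∧ x ≤ P.lfp g} <| by
    intro c hcs hc
    obtain ⟨b, hb⟩ := P.exists_isLUB_of_isChain σ c hc
    exact ⟨b, ⟨hb.2 fun x hx => (hcs hx).1.trans (hf (hb.1 hx)),
      hb.2 fun x hx => (hcs hx).2.1, hb.2 fun x hx => (hcs hx).2.2⟩, fun x hx => hb.1 hx⟩
  have hfm : f m ≤ m := hm.2 ⟨hf hm.1.1, (hf hm.1.2.1).trans (le_of_eq (P.isLeast_lfp hf).1),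
    ((hf hm.1.2.2).trans (h _)).trans (le_of_eq (P.isLeast_lfp hg).1)⟩ hm.1.1
  exact ((P.isLeast_lfp hf).2 (le_antisymm hfm hm.1.1)).trans hm.1.2.2

theorem Env.update_mono {ρ ρ' : Env} (hρ : ∀ τ j, ρ τ j ≤ ρ' τ j) {σ : Ty} (i : ℕ) {φ φ' : P σ}
    (hφ : φ ≤ φ') (τ : Ty) (j : ℕ) : ρ.update i φ τ j ≤ ρ'.update i φ' τ j := by
  unfold Env.update
  split_ifs with e
  · obtain ⟨rfl, rfl⟩ := e
    exact hφ
  · exact hρ τ j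

theorem Term.interp_mono {σ : Ty} (t : Term σ) : ∀ {ρ ρ' : Env}, (∀ τ j, ρ τ j ≤ ρ' τ j) →
    t.interp ρ ≤ t.interp ρ' := by
  induction t with
  | zero => exact fun _ => le_rfl
  | suc => exact fun _ => le_rfl
  | pred => exact fun _ => le_rfl
  | case t₁ t₂ t₃ ih₁ ih₂ ih₃ =>
    exact fun h => P.case_mono (ih₁ h) (ih₂ h) (ih₃ h)
  | var _ i => exact fun h => h _ i
  | const => exact fun _ => le_rfl
  | app t s iht ihs => exact fun h => P.app_mono (iht h) (ihs h)
  | lam _ i t ih => exact fun h ξ => ih (Env.update_mono h i le_rfl)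
  | mu _ i t ih =>
    intro ρ ρ' h
    exact P.lfp_mono (fun _ _ hψ => ih (Env.update_mono (fun _ _ => le_rfl) i hψ))
      (fun _ _ hψ => ih (Env.update_mono (fun _ _ => le_rfl) i hψ))
      (fun ψ => ih (Env.update_mono h i le_rfl))

/-- `[[μ x t]]` is the least fixed point of `ψ ↦ [[t]](x := ψ)`. -/
theorem Term.isLeast_interp_mu {σ : Ty} (h : σ.rank ≤ 3) (i : ℕ) (t : Term σ) (ρ : Env) :
    IsLeast {ψ | t.interp (ρ.update i ψ) = ψ} ((Term.mu h i t).interp ρ) :=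
  P.isLeast_lfp fun _ _ hψ => t.interp_mono (Env.update_mono (fun _ _ => le_rfl) i hψ)

end PartialLambda

/-!
Every rule for values preserves the interpretation: to a rule with arguments `t₂ ⋯ tₙ` corresponds
an equation between interpretations of iterated applications, and an argument all of whose values
exist denotes a total functional. Hence a value of `T[t]` is the denotation of `t`; in particular
values are unique, so the derivation of a value already runs through all immediate subtrees, and
the tree is well-founded.

Conversely, a closed term realizes a partial functional if it computes at least the values of this
functional, on all arguments realizing total functionals. By induction on `t`, every closed instance
of `t` realizes the interpretation of `t`. Only the case of `μ` needs an idea: since a value in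
`ℕ ∪ {⊥}` is attained at some member of every set with this supremum, realizability is preserved by
suprema, and so a least fixed point is realized as soon as the step function preserves
realizability.
-/

namespace PartialLambda

/-! ### Suprema and least fixed points -/

theorem mem_of_isLUB_some {α : Type*} {c : Set (Part α)} {a : α} (h : IsLUB c (Part.some a)) :
    Part.some a ∈ c := by
  by_contra hac
  have none_upper : Part.none ∈ upperBounds c := fun x hx b hb => by
    obtain rfl : b = a := Part.mem_some_iff.1 (h.1 hx b hb)
    exact (hac (Part.eq_some_iff.2 hb ▸ hx)).elim
  exact Part.notMem_none a (h.2 none_upper a (Part.mem_some a))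

theorem isLeast_fixedPoint_induction {α : Type*} [PartialOrder α]
    (exists_lub : ∀ c : Set α, IsChain (· ≤ ·) c → ∃ b, IsLUB c b) {f : α → α} (hf : Monotone f)
    {a : α} (ha : IsLeast {x | f x = x} a) {p : α → Prop}
    (lub : ∀ c b, IsLUB c b → (∀ x ∈ c, p x) → p b) (step : ∀ x, p x → p (f x)) : p a := by
  obtain ⟨m, ⟨hm, hma, hpm⟩, hmax⟩ := zorn_le₀ {x | x ≤ f x ∧ x ≤ a ∧ p x} fun c hcs hc => by
    obtain ⟨b, hb⟩ := exists_lub c hc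
    exact ⟨b, ⟨hb.2 fun x hx => (hcs hx).1.trans (hf (hb.1 hx)),
      hb.2 fun x hx => (hcs hx).2.1, lub c b hb fun x hx => (hcs hx).2.2⟩, fun x hx => hb.1 hx⟩
  have hfm : f m ≤ m := hmax ⟨hf hm, (hf hma).trans ha.1.le, step m hpm⟩ hm
  rwa [← hma.antisymm (ha.2 (hfm.antisymm hm))]

/-! ### Closed terms and substitution -/

theorem Env.update_self (ρ : Env) {σ : Ty} (i : ℕ) (φ : P σ) : ρ.update i φ σ i = φ := by
  simp [Env.update]

theorem Env.update_of_ne (ρ : Env) {σ τ : Ty} {i j : ℕ} (φ : P σ) (h : ¬ (σ = τ ∧ j = i)) :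
    ρ.update i φ τ j = ρ τ j := by
  simp only [Env.update, dif_neg h]

theorem Env.update_update (ρ : Env) {σ : Ty} (i : ℕ) (φ ψ : P σ) :
    (ρ.update i φ).update i ψ = ρ.update i ψ := by
  funext τ j
  unfold Env.update
  split_ifs <;> rfl

theorem Env.update_comm (ρ : Env) {σ τ : Ty} {i j : ℕ} (φ : P σ) (ψ : P τ)
    (h : ¬ (σ = τ ∧ j = i)) :
    (ρ.update i φ).update j ψ = (ρ.update j ψ).update i φ := by
  funext υ k
  unfold Env.update
  split_ifs with hψ hφ
  · exact (h ⟨hφ.1.trans hψ.1.symm, hψ.2.symm.trans hφ.2⟩).elim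
  all_goals rfl

theorem Env.update_congr {ρ ρ' : Env} {σ τ : Ty} {i j : ℕ} (φ : P σ)
    (h : ¬ (σ = τ ∧ i = j) → ρ τ j = ρ' τ j) : ρ.update i φ τ j = ρ'.update i φ τ j := by
  unfold Env.update
  split_ifs with e
  · rfl
  · exact h fun e' => e ⟨e'.1, e'.2.symm⟩

theorem Term.interp_congr {τ : Ty} (t : Term τ) : ∀ {ρ ρ' : Env},
    (∀ σ i, t.FreeIn σ i → ρ σ i = ρ' σ i) → t.interp ρ = t.interp ρ' := by
  induction t with
  | zero | suc | pred | const => exact fun _ => rfl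
  | case t₁ t₂ t₃ ih₁ ih₂ ih₃ =>
    intro ρ ρ' h
    rw [Term.interp, Term.interp, ih₁ fun σ i hi => h σ i (.inl hi),
      ih₂ fun σ i hi => h σ i (.inr (.inl hi)), ih₃ fun σ i hi => h σ i (.inr (.inr hi))]
  | var _ i => exact fun h => h _ i ⟨rfl, rfl⟩
  | app t s iht ihs =>
    intro ρ ρ' h
    rw [Term.interp, Term.interp, iht fun σ i hi => h σ i (.inl hi),
      ihs fun σ i hi => h σ i (.inr hi)]
  | lam _ j t ih =>
    exact fun h => funext fun ξ => ih fun σ i hi => Env.update_congr _ fun e => h σ i ⟨e, hi⟩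
  | mu _ j t ih =>
    exact fun h => congrArg P.lfp <| funext fun ψ =>
      ih fun σ i hi => Env.update_congr _ fun e => h σ i ⟨e, hi⟩

theorem Term.Closed.interp_eq {τ : Ty} {t : Term τ} (ht : t.Closed) (ρ ρ' : Env) :
    t.interp ρ = t.interp ρ' :=
  t.interp_congr fun σ i hi => (ht σ i hi).elim

theorem Term.closed_const {σ : Ty} (h : σ.rank ≤ 3) (φ : P σ) : (Term.const h φ).Closed :=
  fun _ _ => id

theorem Term.closed_app {σ τ : Ty} {t : Term (.arrow σ τ)} {s : Term σ} :
    (Term.app t s).Closed ↔ t.Closed ∧ s.Closed := by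
  simp only [Term.Closed, Term.FreeIn, not_or, forall_and]

theorem Term.closed_case {t₁ t₂ t₃ : Term .zero} :
    (Term.case t₁ t₂ t₃).Closed ↔ t₁.Closed ∧ t₂.Closed ∧ t₃.Closed := by
  simp only [Term.Closed, Term.FreeIn, not_or, forall_and]

/-- All terms of a list of arguments are closed. -/
def Args.Closed : {σ : Ty} → Args σ → Prop
  | _, .nil => True
  | _, .cons s ts => s.Closed ∧ ts.Closed

theorem Term.closed_apps {σ : Ty} {t : Term σ} {ts : Args σ} :
    (t.apps ts).Closed ↔ t.Closed ∧ ts.Closed := by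
  induction ts with
  | nil => simp only [Term.apps, Args.Closed, and_true]
  | cons s ts ih => rw [Term.apps, ih, Term.closed_app, Args.Closed, and_assoc]

theorem Term.Closed.applyTotal : {σ : Ty} → {t : Term σ} → t.Closed → (ξs : Inputs σ) →
    (t.applyTotal ξs).Closed
  | .zero, _, ht, _ => ht
  | .arrow _ _, _, ht, ξs =>
    Term.Closed.applyTotal (Term.closed_app.2 ⟨ht, Term.closed_const _ _⟩) ξs.2

theorem Term.interp_subst {τ σ : Ty} (t : Term τ) (i : ℕ) {s : Term σ} (hs : s.Closed) :
    ∀ ρ : Env, (t.subst i s).interp ρ = t.interp (ρ.update i (s.interp ρ)) := by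
  have interp_body {υ τ : Ty} {t : Term τ}
      (ih : ∀ ρ : Env, (t.subst i s).interp ρ = t.interp (ρ.update i (s.interp ρ)))
      (ρ : Env) (j : ℕ) (φ : P υ) :
      (if σ = υ ∧ j = i then t else t.subst i s).interp (ρ.update j φ) =
        t.interp ((ρ.update i (s.interp ρ)).update j φ) := by
    split_ifs with e
    · obtain ⟨rfl, rfl⟩ := e
      rw [Env.update_update]
    · rw [ih, hs.interp_eq (ρ.update j φ) ρ, Env.update_comm _ _ _ e]
  induction t with
  | zero | suc | pred | const => exact fun _ => rfl
  | case t₁ t₂ t₃ ih₁ ih₂ ih₃ =>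
    intro ρ
    rw [Term.subst, Term.interp, Term.interp, ih₁, ih₂, ih₃]
  | var h j =>
    intro ρ
    rw [Term.subst, Term.interp]
    split_ifs with e
    · obtain ⟨rfl, rfl⟩ := e
      rw [Env.update_self]
    · rw [Env.update_of_ne _ _ e, Term.interp]
  | app t u iht ihu =>
    intro ρ
    rw [Term.subst, Term.interp, Term.interp, iht, ihu]
  | lam _ j t ih => exact fun ρ => funext fun ξ => interp_body ih ρ j ξ.toP
  | mu _ j t ih => exact fun ρ => congrArg P.lfp (funext fun ψ => interp_body ih ρ j ψ)

theorem Term.freeIn_of_subst {τ σ υ : Ty} {t : Term τ} {i j : ℕ} {s : Term σ} (hs : s.Closed) :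
    (t.subst i s).FreeIn υ j → ¬ (σ = υ ∧ i = j) ∧ t.FreeIn υ j := by
  induction t with
  | zero | suc | pred | const => exact False.elim
  | case t₁ t₂ t₃ ih₁ ih₂ ih₃ =>
    rintro (h | h | h)
    · exact (ih₁ h).imp_right .inl
    · exact (ih₂ h).imp_right (.inr ∘ .inl)
    · exact (ih₃ h).imp_right (.inr ∘ .inr)
  | var h k =>
    rw [Term.subst]
    split_ifs with e
    · obtain ⟨rfl, rfl⟩ := e
      exact fun h => (hs _ _ h).elim
    · rintro ⟨rfl, rfl⟩
      exact ⟨fun e' => e ⟨e'.1, e'.2.symm⟩, rfl, rfl⟩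
  | app t u iht ihu =>
    rintro (h | h)
    · exact (iht h).imp_right .inl
    · exact (ihu h).imp_right .inr
  | lam h k t ih | mu h k t ih =>
    simp only [Term.subst, Term.FreeIn]
    split_ifs with e
    · obtain ⟨rfl, rfl⟩ := e
      exact fun h => ⟨h.1, h⟩
    · exact fun h => ⟨(ih h.2).1, h.1, (ih h.2).2⟩

theorem Term.Closed.subst_of_lam {σ τ : Ty} {h : (Ty.arrow σ τ).rank ≤ 3} {i : ℕ} {t : Term τ}
    (ht : (Term.lam h i t).Closed) {s : Term σ} (hs : s.Closed) : (t.subst i s).Closed :=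
  fun υ j hj => ht υ j (Term.freeIn_of_subst hs hj)

theorem Term.Closed.subst_of_mu {σ : Ty} {h : σ.rank ≤ 3} {i : ℕ} {t : Term σ}
    (ht : (Term.mu h i t).Closed) {s : Term σ} (hs : s.Closed) : (t.subst i s).Closed :=
  fun υ j hj => ht υ j (Term.freeIn_of_subst hs hj)

theorem Term.subst_of_not_freeIn {τ σ : Ty} {t : Term τ} {i : ℕ} (s : Term σ) :
    ¬ t.FreeIn σ i → t.subst i s = t := by
  induction t with
  | zero | suc | pred | const => exact fun _ => rfl
  | case t₁ t₂ t₃ ih₁ ih₂ ih₃ =>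
    intro h
    simp only [Term.FreeIn, not_or] at h
    rw [Term.subst, ih₁ h.1, ih₂ h.2.1, ih₃ h.2.2]
  | var h j => exact fun h => dif_neg fun e => h ⟨e.1.symm, e.2⟩
  | app t u iht ihu =>
    intro h
    simp only [Term.FreeIn, not_or] at h
    rw [Term.subst, iht h.1, ihu h.2]
  | lam h j t ih | mu h j t ih =>
    intro hfree
    rw [Term.subst]
    split_ifs with e
    · rfl
    · rw [ih fun hi => hfree ⟨fun e' => e ⟨e'.1.symm, e'.2⟩, hi⟩]

theorem Term.Closed.subst_eq {τ σ : Ty} {t : Term τ} (ht : t.Closed) (i : ℕ) (s : Term σ) :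
    t.subst i s = t :=
  Term.subst_of_not_freeIn s (ht σ i)

theorem Child.closed {t c : Term .zero} (h : Child t c) (ht : t.Closed) : c.Closed := by
  cases h with
  | suc | pred => exact (Term.closed_app.1 ht).2
  | case_test => exact (Term.closed_case.1 ht).1
  | case_zero => exact (Term.closed_case.1 ht).2.1
  | case_succ => exact (Term.closed_case.1 ht).2.2
  | const_arg _ _ ξs | lam_arg _ _ ξs => exact (Term.closed_apps.1 ht).2.1.applyTotal ξs
  | const_val =>
    exact Term.closed_apps.2 ⟨Term.closed_const _ _, (Term.closed_apps.1 ht).2.2⟩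
  | lam_body =>
    obtain ⟨hlam, harg, hargs⟩ := Term.closed_apps.1 ht
    exact Term.closed_apps.2 ⟨hlam.subst_of_lam harg, hargs⟩
  | mu =>
    obtain ⟨hmu, hargs⟩ := Term.closed_apps.1 ht
    exact Term.closed_apps.2 ⟨hmu.subst_of_mu hmu, hargs⟩

/-! ### Soundness of values -/

theorem Term.interp_apps_congr {σ : Ty} {t s : Term σ} {ρ : Env} (ts : Args σ)
    (h : t.interp ρ = s.interp ρ) : (t.apps ts).interp ρ = (s.apps ts).interp ρ := by
  induction ts with
  | nil => exact h
  | cons a _ ih => exact ih (congrArg (fun u => P.app u (a.interp ρ)) h)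

theorem Term.interp_app_of_eq_toP {σ τ : Ty} {t : Term (.arrow σ τ)} {s : Term σ} {ρ : Env}
    {ξ : F σ} (h : s.interp ρ = ξ.toP) : (t.app s).interp ρ = t.interp ρ ξ := by
  rw [Term.interp, h, P.app_toP]

theorem Term.interp_eq_toP {σ : Ty} {t : Term σ} {Ψ : F σ} {ρ : Env}
    (h : ∀ ξs : Inputs σ, (t.applyTotal ξs).interp ρ = (Part.some (Ψ.eval ξs) : Part ℕ)) :
    t.interp ρ = Ψ.toP := by
  induction σ with
  | zero => exact h ()
  | arrow σ τ _ ih =>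
    funext ξ
    rw [← t.interp_app_of_eq_toP (s := .const (Ty.rank_dom t.rank_le) ξ.toP) rfl]
    exact ih (Ψ := Ψ ξ) fun ξs => h (ξ, ξs)

theorem Term.Closed.interp_mu_eq_interp_subst {σ : Ty} {h : σ.rank ≤ 3} {i : ℕ} {t : Term σ}
    (ht : (Term.mu h i t).Closed) (ρ : Env) :
    (Term.mu h i t).interp ρ = (t.subst i (.mu h i t)).interp ρ := by
  rw [Term.interp_subst t i ht]
  exact (Term.isLeast_interp_mu h i t ρ).1.symm

theorem TreeValue.interp_eq {t : Term .zero} {n : ℕ} (h : TreeValue t n) (ht : t.Closed)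
    (ρ : Env) : t.interp ρ = (Part.some n : Part ℕ) := by
  induction h with
  | zero | const_zero => rfl
  | @suc t₁ a _ ih =>
    exact Term.interp_app_of_eq_toP (σ := .zero) (ξ := a) (ih (Child.suc.closed ht))
  | @pred t₁ a _ ih =>
    exact Term.interp_app_of_eq_toP (σ := .zero) (ξ := a) (ih (Child.pred.closed ht))
  | case_zero h₁ _ ih₁ ih₂ =>
    rw [Term.interp, ih₁ (Child.case_test.closed ht), ih₂ ((Child.case_zero h₁).closed ht)]
    exact Part.bind_some _ _
  | case_succ h₁ _ ih₁ ih₂ =>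
    rw [Term.interp, ih₁ (Child.case_test.closed ht), ih₂ ((Child.case_succ h₁).closed ht)]
    exact Part.bind_some _ _
  | @const σ τ h Φ t₂ ts Ψ n h₁ _ ih₁ ih₂ =>
    have harg : t₂.interp ρ = Ψ.toP :=
      Term.interp_eq_toP fun ξs => ih₁ ξs ((Child.const_arg h Φ ξs).closed ht)
    rw [← ih₂ ((Child.const_val h Φ Ψ h₁).closed ht)]
    exact Term.interp_apps_congr ts (Term.interp_app_of_eq_toP harg)
  | @lam σ τ h i t₁ t₂ ts Ψ n h₁ _ ih₁ ih₂ =>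
    have harg : t₂.interp ρ = Ψ.toP :=
      Term.interp_eq_toP fun ξs => ih₁ ξs ((Child.lam_arg h i ξs).closed ht)
    rw [← ih₂ ((Child.lam_body h i Ψ h₁).closed ht)]
    refine Term.interp_apps_congr ts ?_
    rw [Term.interp_app_of_eq_toP harg, Term.interp_subst _ _ (Term.closed_apps.1 ht).2.1, harg,
      Term.interp]
  | mu h i _ ih =>
    rw [← ih ((Child.mu h i).closed ht)]
    exact Term.interp_apps_congr _ ((Term.closed_apps.1 ht).1.interp_mu_eq_interp_subst ρ)

theorem TreeValue.unique {t : Term .zero} {m n : ℕ} (hm : TreeValue t m) (hn : TreeValue t n)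
    (ht : t.Closed) : m = n :=
  Part.some_injective ((hm.interp_eq ht fun σ _ => P.undef σ).symm.trans (hn.interp_eq ht _))

theorem F.eval_injective : {σ : Ty} → Function.Injective (F.eval (σ := σ))
  | .zero => fun _ _ h => congrFun h ()
  | .arrow _ _ => fun _ _ h => funext fun ξ => F.eval_injective <| funext fun ξs =>
    congrFun h (ξ, ξs)

/-! ### Well-foundedness -/

/-- The roots of the immediate subtrees of the tree of `t t₂ ⋯ tₙ`, computed by recursion on the
head `t`. Unlike for `Child`, the rule for a given head is found by reduction, without inverting
equations between iterated applications. -/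
def Term.subtreeRoots : {σ : Ty} → Term σ → Args σ → Set (Term .zero)
  | _, .app t s, ts => t.subtreeRoots (.cons s ts)
  | _, .suc, .cons t₁ _ => {t₁}
  | _, .pred, .cons t₁ _ => {t₁}
  | _, .case t₁ t₂ t₃, _ =>
    {c | c = t₁ ∨ TreeValue t₁ 0 ∧ c = t₂ ∨ (∃ a, TreeValue t₁ (a + 1)) ∧ c = t₃}
  | .arrow σ _, .const h Φ, .cons t₂ ts =>
    {c | (∃ ξs, c = t₂.applyTotal ξs) ∨ ∃ Ψ : F σ,
      (∀ ξs, TreeValue (t₂.applyTotal ξs) (Ψ.eval ξs)) ∧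
        c = (Term.const (Ty.rank_cod h) (Φ Ψ)).apps ts}
  | .arrow _ _, .lam _ i t₁, .cons t₂ ts =>
    {c | (∃ ξs, c = t₂.applyTotal ξs) ∨ c = (t₁.subst i t₂).apps ts}
  | _, .mu h i t₁, ts => {(t₁.subst i (.mu h i t₁)).apps ts}
  | _, _, _ => ∅

theorem Term.subtreeRoots_apps {σ : Ty} (t : Term σ) (ts : Args σ) :
    (t.apps ts).subtreeRoots .nil = t.subtreeRoots ts := by
  induction ts with
  | nil => rfl
  | cons s ts ih => exact (ih _).trans (by rw [Term.subtreeRoots])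

theorem Child.mem_subtreeRoots {t c : Term .zero} (h : Child t c) : c ∈ t.subtreeRoots .nil := by
  cases h with
  | suc | pred => exact rfl
  | case_test => exact .inl rfl
  | case_zero h₁ => exact .inr (.inl ⟨h₁, rfl⟩)
  | case_succ h₁ => exact .inr (.inr ⟨⟨_, h₁⟩, rfl⟩)
  | const_arg _ _ ξs | lam_arg _ _ ξs =>
    rw [Term.subtreeRoots_apps]
    exact .inl ⟨ξs, rfl⟩
  | const_val _ _ Ψ hΨ =>
    rw [Term.subtreeRoots_apps]
    exact .inr ⟨Ψ, hΨ, rfl⟩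
  | lam_body =>
    rw [Term.subtreeRoots_apps]
    exact .inr rfl
  | mu =>
    rw [Term.subtreeRoots_apps, Term.subtreeRoots]
    exact rfl

theorem Child.mem_subtreeRoots_of_apps {σ : Ty} {t : Term σ} {ts : Args σ} {c : Term .zero}
    (h : Child (t.apps ts) c) : c ∈ t.subtreeRoots ts :=
  t.subtreeRoots_apps ts ▸ h.mem_subtreeRoots

theorem TreeValue.acc {t : Term .zero} {n : ℕ} (h : TreeValue t n) (ht : t.Closed) :
    Acc (fun s t => Child t s) t := by
  induction h with
  | zero | const_zero => exact ⟨_, fun c hc => hc.mem_subtreeRoots.elim⟩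
  | suc _ ih | pred _ ih =>
    refine ⟨_, fun c hc => ?_⟩
    obtain rfl := hc.mem_subtreeRoots
    exact ih (hc.closed ht)
  | case_zero h₁ _ ih₁ ih₂ =>
    refine ⟨_, fun c hc => ?_⟩
    obtain rfl | ⟨-, rfl⟩ | ⟨⟨a, ha⟩, -⟩ := hc.mem_subtreeRoots
    · exact ih₁ (hc.closed ht)
    · exact ih₂ (hc.closed ht)
    · exact (Nat.succ_ne_zero a (ha.unique h₁ (Child.case_test.closed ht))).elim
  | case_succ h₁ _ ih₁ ih₂ =>
    refine ⟨_, fun c hc => ?_⟩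
    obtain rfl | ⟨h₀, -⟩ | ⟨-, rfl⟩ := hc.mem_subtreeRoots
    · exact ih₁ (hc.closed ht)
    · exact (Nat.succ_ne_zero _ (h₁.unique h₀ (Child.case_test.closed ht))).elim
    · exact ih₂ (hc.closed ht)
  | const h Φ Ψ h₁ _ ih₁ ih₂ =>
    refine ⟨_, fun c hc => ?_⟩
    obtain ⟨ξs, rfl⟩ | ⟨Ψ', h₁', rfl⟩ := hc.mem_subtreeRoots_of_apps
    · exact ih₁ ξs (hc.closed ht)
    · obtain rfl : Ψ = Ψ' := F.eval_injective <| funext fun ξs =>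
        (h₁ ξs).unique (h₁' ξs) ((Child.const_arg h Φ ξs).closed ht)
      exact ih₂ (hc.closed ht)
  | lam _ _ _ _ _ ih₁ ih₂ =>
    refine ⟨_, fun c hc => ?_⟩
    obtain ⟨ξs, rfl⟩ | rfl := hc.mem_subtreeRoots_of_apps
    · exact ih₁ ξs (hc.closed ht)
    · exact ih₂ (hc.closed ht)
  | mu _ _ _ ih =>
    refine ⟨_, fun c hc => ?_⟩
    have hroot := hc.mem_subtreeRoots_of_apps
    rw [Term.subtreeRoots] at hroot
    obtain rfl := hroot
    exact ih (hc.closed ht)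

theorem InTree.head_eq {t a : Term .zero} {l : List (Term .zero)} (h : InTree t (a :: l)) :
    a = t := by
  cases h <;> rfl

theorem InTree.isChain {t : Term .zero} {l : List (Term .zero)} (h : InTree t l) :
    l.IsChain Child := by
  induction h with
  | root => exact .nil
  | single t => exact .singleton t
  | @step t s l hts hl ih =>
    cases l with
    | nil => exact .singleton t
    | cons a l =>
      obtain rfl := hl.head_eq
      exact .cons_cons hts ih

theorem wellFoundedTree_of_acc {t : Term .zero} (h : Acc (fun s t => Child t s) t) :
    WellFoundedTree (tree t) := by
  rintro ⟨f, hf⟩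
  have head_eq : f 0 = t := InTree.head_eq (hf 1)
  have child_succ (k : ℕ) : Child (f k) (f (k + 1)) := by
    have := (List.isChain_map f).1 (InTree.isChain (hf (k + 2)))
    exact (List.isChain_range_succ _ (k + 1)).1 this k k.lt_succ_self
  exact not_acc_iff_exists_descending_chain.2 ⟨f, head_eq, child_succ⟩ h

/-! ### Closing substitutions -/

/-- The pair `(σ, i)` stands for the variable `x_i^σ`. -/
abbrev Var : Type := Ty × ℕ

/-- A simultaneous substitution of closed terms for variables; a variable that is sent to `none`
is left unchanged. -/
abbrev ClosedSubst : Type := (v : Var) → Option {s : Term v.1 // s.Closed}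

/-- The term `t` after the simultaneous substitution `γ`. Since only closed terms are substituted,
no variable is captured. -/
def Term.msubst : {τ : Ty} → Term τ → ClosedSubst → Term τ
  | _, .zero, _ => .zero
  | _, .suc, _ => .suc
  | _, .pred, _ => .pred
  | _, .case t₁ t₂ t₃, γ => .case (t₁.msubst γ) (t₂.msubst γ) (t₃.msubst γ)
  | τ, .var h j, γ => (γ (τ, j)).elim (.var h j) Subtype.val
  | _, .const h φ, _ => .const h φ
  | _, .app t u, γ => .app (t.msubst γ) (u.msubst γ)
  | _, .lam (σ := σ) h j t, γ => .lam h j (t.msubst (Function.update γ (σ, j) none))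
  | _, .mu (σ := σ) h j t, γ => .mu h j (t.msubst (Function.update γ (σ, j) none))

theorem Term.msubst_none {τ : Ty} (t : Term τ) : t.msubst (fun _ => none) = t := by
  have update_none (v : Var) :
      Function.update (fun _ => none : ClosedSubst) v none = fun _ => none :=
    Function.update_eq_self v _
  induction t <;> simp only [Term.msubst, Option.elim_none, *]

theorem Term.msubst_update_none_subst {τ σ : Ty} (t : Term τ) (i : ℕ) {s : Term σ}
    (hs : s.Closed) : ∀ γ : ClosedSubst,
    (t.msubst (Function.update γ (σ, i) none)).subst i s =
      t.msubst (Function.update γ (σ, i) (some ⟨s, hs⟩)) := by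
  induction t with
  | zero | suc | pred | const => exact fun _ => rfl
  | case t₁ t₂ t₃ ih₁ ih₂ ih₃ =>
    intro γ
    rw [Term.msubst, Term.subst, ih₁, ih₂, ih₃, Term.msubst]
  | @var σ' h j =>
    intro γ
    rw [Term.msubst, Term.msubst]
    by_cases e : σ = σ' ∧ j = i
    · obtain ⟨rfl, rfl⟩ := e
      simp only [Function.update_self, Option.elim_none, Option.elim_some, Term.subst, and_self,
        dif_pos]
    · have hne : (σ', j) ≠ (σ, i) := by
        rintro ⟨⟩
        exact e ⟨rfl, rfl⟩
      rw [Function.update_of_ne hne, Function.update_of_ne hne]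
      cases γ (σ', j) with
      | none => exact dif_neg e
      | some u => exact u.2.subst_eq i s
  | app t u iht ihu =>
    intro γ
    rw [Term.msubst, Term.subst, iht, ihu, Term.msubst]
  | @lam σ' _ h j t ih | @mu σ' h j t ih =>
    intro γ
    rw [Term.msubst, Term.subst, Term.msubst]
    split_ifs with e
    · obtain ⟨rfl, rfl⟩ := e
      rw [Function.update_idem, Function.update_idem]
    · have hne : (σ, i) ≠ (σ', j) := by
        rintro ⟨⟩
        exact e ⟨rfl, rfl⟩
      rw [Function.update_comm hne, ih, Function.update_comm hne]

/-! ### Adequacy -/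

/-- The logical relation between closed terms and partial functionals: `t` computes at least the
values of `φ`, on all arguments that realize total functionals. -/
def Realizes : {σ : Ty} → Term σ → P σ → Prop
  | .zero, t, φ => ∀ n : ℕ, φ = (Part.some n : Part ℕ) → TreeValue t n
  | .arrow σ _, t, φ =>
    ∀ (ξ : F σ) (s : Term σ), s.Closed → Realizes s ξ.toP → Realizes (t.app s) (φ ξ)

theorem Realizes.of_treeValue_imp {σ : Ty} {t s : Term σ} {φ : P σ} (h : Realizes t φ)
    (hts : ∀ (ts : Args σ) (n : ℕ), TreeValue (t.apps ts) n → TreeValue (s.apps ts) n) :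
    Realizes s φ := by
  induction σ with
  | zero => exact fun n hn => hts .nil n (h n hn)
  | arrow σ τ _ ih => exact fun ξ u hu hξ => ih (h ξ u hu hξ) fun ts n => hts (.cons u ts) n

theorem realizes_undef {σ : Ty} (t : Term σ) : Realizes t (P.undef σ) := by
  induction σ with
  | zero => exact fun n hn => (Part.some_ne_none n hn.symm).elim
  | arrow σ τ _ ih => exact fun ξ s _ _ => ih _

mutual

theorem Realizes.treeValue_applyTotal : {σ : Ty} → {t : Term σ} → {ξ : F σ} →
    Realizes t ξ.toP → (ξs : Inputs σ) → TreeValue (t.applyTotal ξs) (ξ.eval ξs)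
  | .zero, _, ξ, h, _ => h ξ rfl
  | .arrow _ _, _, _, h, ξs =>
    Realizes.treeValue_applyTotal
      (h ξs.1 _ (Term.closed_const _ _) (realizes_const _ _)) ξs.2

theorem realizes_const : {σ : Ty} → (h : σ.rank ≤ 3) → (φ : P σ) → Realizes (.const h φ) φ
  | .zero, h, _ => fun n hn => hn ▸ .const_zero h n
  | .arrow _ _, h, φ => fun ξ _ _ hξ =>
    (realizes_const (Ty.rank_cod h) (φ ξ)).of_treeValue_imp fun _ _ hn =>
      .const h φ ξ (Realizes.treeValue_applyTotal hξ) hn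

end

theorem Realizes.of_isLUB {σ : Ty} {t : Term σ} {c : Set (P σ)} {b : P σ} (hb : IsLUB c b)
    (hc : ∀ φ ∈ c, Realizes t φ) : Realizes t b := by
  induction σ with
  | zero =>
    rintro n rfl
    exact hc _ (mem_of_isLUB_some hb) n rfl
  | arrow σ τ _ ih =>
    intro ξ s hs hξ
    refine ih ((isLUB_pi (π := fun _ : F σ => P τ)).1 hb ξ) ?_
    rintro _ ⟨φ, hφ, rfl⟩
    exact hc φ hφ ξ s hs hξ

theorem Realizes.lam {σ τ : Ty} {h : (Ty.arrow σ τ).rank ≤ 3} {i : ℕ} {t : Term τ}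
    {φ : P (.arrow σ τ)}
    (hbody : ∀ (ξ : F σ) (s : Term σ), s.Closed → Realizes s ξ.toP →
      Realizes (t.subst i s) (φ ξ)) :
    Realizes (.lam h i t) φ :=
  fun ξ s hs hξ => (hbody ξ s hs hξ).of_treeValue_imp fun _ _ hn =>
    .lam h i ξ hξ.treeValue_applyTotal hn

theorem Realizes.mu {σ : Ty} {h : σ.rank ≤ 3} {i : ℕ} {t : Term σ} {f : P σ → P σ}
    (hf : Monotone f)
    (hbody : ∀ ψ, Realizes (.mu h i t) ψ → Realizes (t.subst i (.mu h i t)) (f ψ)) :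
    Realizes (.mu h i t) (P.lfp f) :=
  isLeast_fixedPoint_induction (P.exists_isLUB_of_isChain σ) hf (P.isLeast_lfp hf)
    (fun _ _ => Realizes.of_isLUB) fun ψ hψ =>
      (hbody ψ hψ).of_treeValue_imp fun _ _ hn => .mu h i hn

theorem Realizes.app {σ τ : Ty} {t : Term (.arrow σ τ)} {s : Term σ} {φ : P (.arrow σ τ)}
    {ψ : P σ} (ht : Realizes t φ) (hs : Realizes s ψ) (hsc : s.Closed) :
    Realizes (t.app s) (P.app φ ψ) := by
  by_cases h : ∃ ξ : F σ, ξ.toP = ψ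
  · obtain ⟨ξ, rfl⟩ := h
    rw [P.app_toP]
    exact ht ξ s hsc hs
  · rw [P.app, dif_neg h]
    exact realizes_undef _

theorem Realizes.case {t₁ t₂ t₃ : Term .zero} {z x y : P .zero} (h₁ : Realizes t₁ z)
    (h₂ : Realizes t₂ x) (h₃ : Realizes t₃ y) :
    Realizes (.case t₁ t₂ t₃) (P.case z x y : P .zero) := by
  intro n hn
  obtain ⟨k, hk, hn⟩ := Part.mem_bind_iff.1 (Part.eq_some_iff.1 hn)
  have test := h₁ k (Part.eq_some_iff.2 hk)
  cases k with
  | zero => exact .case_zero test (h₂ n (Part.eq_some_iff.2 hn))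
  | succ k => exact .case_succ test (h₃ n (Part.eq_some_iff.2 hn))

/-- Every closed term substituted by `γ` realizes the functional that `ρ` assigns to the same
variable. -/
def ClosedSubst.RealizesEnv (γ : ClosedSubst) (ρ : Env) : Prop :=
  ∀ v s, γ v = some s → Realizes s.1 (ρ v.1 v.2)

theorem ClosedSubst.RealizesEnv.update {γ : ClosedSubst} {ρ : Env} (hγ : γ.RealizesEnv ρ) {σ : Ty}
    (i : ℕ) {s : Term σ} {φ : P σ} (hs : s.Closed) (hφ : Realizes s φ) :
    ClosedSubst.RealizesEnv (Function.update γ (σ, i) (some ⟨s, hs⟩)) (ρ.update i φ) := by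
  rintro ⟨τ, j⟩ u hu
  by_cases e : σ = τ ∧ j = i
  · obtain ⟨rfl, rfl⟩ := e
    rw [Function.update_self, Option.some_inj] at hu
    rw [Env.update_self, ← hu]
    exact hφ
  · have hne : (τ, j) ≠ (σ, i) := by
      rintro ⟨⟩
      exact e ⟨rfl, rfl⟩
    rw [Function.update_of_ne hne] at hu
    rw [Env.update_of_ne _ _ e]
    exact hγ _ u hu

theorem Term.realizes_msubst {τ : Ty} (t : Term τ) : ∀ {γ : ClosedSubst} {ρ : Env},
    γ.RealizesEnv ρ → (t.msubst γ).Closed → Realizes (t.msubst γ) (t.interp ρ) := by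
  induction t with
  | zero =>
    intro γ ρ _ _ n hn
    obtain rfl : 0 = n := Part.some_injective hn
    exact .zero
  | suc =>
    intro γ ρ _ _ (k : ℕ) s _ hk n hn
    obtain rfl : k + 1 = n := Part.some_injective hn
    exact .suc (hk k rfl)
  | pred =>
    intro γ ρ _ _ (k : ℕ) s _ hk n hn
    obtain rfl : k - 1 = n := Part.some_injective hn
    exact .pred (hk k rfl)
  | case t₁ t₂ t₃ ih₁ ih₂ ih₃ =>
    intro γ ρ hγ hc
    obtain ⟨hc₁, hc₂, hc₃⟩ := Term.closed_case.1 hc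
    exact (ih₁ hγ hc₁).case (ih₂ hγ hc₂) (ih₃ hγ hc₃)
  | @var σ h i =>
    intro γ ρ hγ hc
    rw [Term.msubst] at hc ⊢
    cases hv : γ (σ, i) with
    | none => exact (hc σ i (by rw [hv]; exact ⟨rfl, rfl⟩)).elim
    | some s => exact hγ _ s hv
  | const h φ => exact fun _ _ => realizes_const h φ
  | app t s iht ihs =>
    intro γ ρ hγ hc
    obtain ⟨hct, hcs⟩ := Term.closed_app.1 hc
    exact (iht hγ hct).app (ihs hγ hcs) hcs
  | lam h i t ih =>
    refine fun hγ hc => .lam fun ξ s hs hξ => ?_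
    have hcs := Term.Closed.subst_of_lam hc hs
    rw [Term.msubst_update_none_subst t i hs] at hcs ⊢
    exact ih (hγ.update i hs hξ) hcs
  | mu h i t ih =>
    intro γ ρ hγ hc
    have hcs := Term.Closed.subst_of_mu hc hc
    refine .mu (fun _ _ hψ => t.interp_mono (Env.update_mono (fun _ _ => le_rfl) i hψ)) ?_
    intro ψ hψ
    have hbody := Term.msubst_update_none_subst t i hc γ
    exact hbody ▸ ih (hγ.update i hc hψ) (hbody ▸ hcs)

theorem Term.Closed.realizes_interp {τ : Ty} {t : Term τ} (ht : t.Closed) (ρ : Env) :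
    Realizes t (t.interp ρ) := by
  have hγ : ClosedSubst.RealizesEnv (fun _ => none) ρ :=
    fun v s hs => (Option.some_ne_none s hs.symm).elim
  simpa only [t.msubst_none] using t.realizes_msubst hγ (t.msubst_none.symm ▸ ht)

end PartialLambda

theorem mainTheorem6 (t : PartialLambda.Term PartialLambda.Ty.zero) (ht : t.Closed)
    (ρ : PartialLambda.Env) (n : ℕ) :
    t.interp ρ = (Part.some n : Part ℕ) ↔
      PartialLambda.WellFoundedTree (PartialLambda.tree t) ∧ PartialLambda.TreeValue t n := by
  constructor
  · intro h
    have hvalue : PartialLambda.TreeValue t n := ht.realizes_interp ρ n h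
    exact ⟨PartialLambda.wellFoundedTree_of_acc (hvalue.acc ht), hvalue⟩
  · rintro ⟨-, hvalue⟩
    exact hvalue.interp_eq ht ρ
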